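/- A $3$-Schur overpartition of a nonnegative integer $m$ is a partition of $m$ into odd parts not divisible by $3$ in which the first occurrence of each distinct part may or may not be overlined; let $\overline{S}_3(m)$ denote the number of them, so that $$\sum_{m\ge 0}\overline{S}_3(m)q^m=\prod_{k\ge 1}\frac{(1+q^{2k-1})(1-q^{3(2k-1)})}{(1+q^{3(2k-1)})(1-q^{2k-1})}.$$ Let $p\ge 5$ be a prime with Legendre symbol $\left(\frac{-6}{p}\right)=-1$, and let $i$ be an integer with $1\le i\le p-1$. Then for all integers $\alpha\ge 0$ and $n\ge 0$, $$\overline{S}_3\bigl(48p^{2\alpha+2}n+2(24i+5p)p^{2\alpha+1}\bigr)\equiv 0 \pmod{24}.$$ -/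

import Mathlib

/-- The set `I(t) = {1, 3, 5, …, 2t - 1} \ {t}` of residues modulo `2t` (for odd `t ≥ 3`). -/
def schurResidues (t : ℕ) : Finset ℕ :=
  ((Finset.range (2 * t)).filter (fun i => Odd i)).erase t

/-- The `t`-Schur overpartitions of `n`: a partition of `n` all of whose parts are congruent
modulo `2t` to an element of `I(t)`, together with the set of those distinct part sizes whose
first occurrence is overlined. -/
def schurOverpartitions (t n : ℕ) : Finset (Σ _ : n.Partition, Finset ℕ) :=
  (Finset.univ.filter
      (fun π : n.Partition => ∀ a ∈ π.parts, a % (2 * t) ∈ schurResidues t)).sigma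
    (fun π => π.parts.toFinset.powerset)

/-- The number of `t`-Schur overpartitions of `n`. -/
def schurOverpartitionCount (t n : ℕ) : ℕ :=
  (schurOverpartitions t n).card

/-! Write G for the generating function. Gauss' formula φ(-q) = E₁²/E₂, with Eⱼ = ∏ (1 - q^(jk)),
turns the product for G into φ(-q²)φ(-q³) / (φ(-q)φ(-q⁶)). The congruence splits into moduli 8 and
3, and the argument in question satisfies N ≡ 10 mod 48.

Modulo 8, put φ(-q) = 1 + 2a. Then 1/(1 + 2a) ≡ 1 - 2a + 4a² and a² ≡ a(q²) mod 2, so G is a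
combination of theta series of unary and binary forms (`schurSeries_modEq_eight`). All but x² + 6y²
miss N by congruences mod 16 or mod 3. That last form misses N because -6 is a nonresidue mod p and
p divides N to an odd power (`sq_add_six_mul_sq_ne`).

Modulo 3, φ(-q³) ≡ φ(-q)³ gives G ≡ φ(-q)²/φ(-q²)². Three 2-dissections isolate the exponents 8n + 2
and leave a quotient of cubes, supported on multiples of 3 (`three_dvd_schurOverpartitionCount`).
Since N = 8(6m + 1) + 2, it is covered.

Identities are kept cross-multiplied, so no power series is inverted. -/

/-! ### Finite forms of Gauss' theta identities -/

section GaussFinite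

open Finset

variable {R : Type*} [CommRing R]

/-- Shanks' finite form of Gauss' identity for the theta function `∑ (-1) ^ s q ^ (s ^ 2)`. -/
theorem gauss_square_finite (q : R) (n : ℕ) :
    (∏ k ∈ range n, (1 + q ^ (k + 1))) *
        (1 + 2 * ∑ s ∈ range n, (-1) ^ (s + 1) * q ^ ((s + 1) ^ 2)) =
      ∑ s ∈ range (n + 1), (-1) ^ s * (∏ k ∈ Ico s n, (1 - q ^ (k + 1))) *
        (∏ k ∈ range s, (1 + q ^ k)) * q ^ (s * (n + 1)) := by
  induction n with
  | zero => simp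
  | succ n ih =>
    -- Telescoping: passing from n to n + 1 changes each partial sum by a factor and a single
    -- boundary term. At j = n that term helps supply the new square.
    have key : ∀ j ≤ n, ∑ s ∈ range (j + 1), (-1) ^ s * (∏ k ∈ Ico s (n + 1), (1 - q ^ (k + 1))) *
          (∏ k ∈ range s, (1 + q ^ k)) * q ^ (s * (n + 2)) =
        (1 + q ^ (n + 1)) * ∑ s ∈ range (j + 1), (-1) ^ s * (∏ k ∈ Ico s n, (1 - q ^ (k + 1))) *
          (∏ k ∈ range s, (1 + q ^ k)) * q ^ (s * (n + 1)) +
        (-1) ^ (j + 1) * (∏ k ∈ Ico j n, (1 - q ^ (k + 1))) *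
          (∏ k ∈ range (j + 1), (1 + q ^ k)) * q ^ ((j + 1) * (n + 1)) := by
      intro j
      induction j with
      | zero =>
        intro _
        simp only [zero_add, sum_range_one, prod_range_one, prod_range_zero]
        rw [prod_Ico_succ_top (Nat.zero_le n)]
        ring
      | succ j ihj =>
        intro hj
        rw [sum_range_succ, ihj (by omega), sum_range_succ _ (j + 1),
          prod_Ico_succ_top (by omega : j + 1 ≤ n), prod_eq_prod_Ico_succ_bot (by omega : j < n),
          prod_range_succ _ (j + 1)]
        ring
    -- The factor at k = 0 is 2, the source of the 2 in the theta series.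
    have hD : ∏ k ∈ range (n + 1), (1 + q ^ k) = 2 * ∏ k ∈ range n, (1 + q ^ (k + 1)) := by
      rw [prod_range_succ']
      simp only [pow_zero]
      ring
    rw [sum_range_succ _ (n + 1), show n + 1 + 1 = n + 2 from rfl, key n le_rfl, ← ih,
      prod_range_succ _ n, sum_range_succ _ n, hD, Ico_self, Ico_self, prod_empty]
    ring

/-- Shanks' finite form of Gauss' identity for the theta function of the triangular numbers. -/
theorem gauss_triangular_finite (q : R) (n : ℕ) :
    (∏ k ∈ range n, (1 - q ^ (2 * k + 1))) *
        ∑ k ∈ range n, (q ^ (k * (2 * k + 1)) + q ^ ((k + 1) * (2 * k + 1))) =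
      ∑ s ∈ range n, (∏ k ∈ Ico s n, (1 - q ^ (2 * (k + 1)))) *
        (∏ k ∈ range s, (1 - q ^ (2 * k + 1))) * q ^ (s * (2 * n + 1)) := by
  induction n with
  | zero => simp
  | succ n ih =>
    have key : ∀ j ≤ n, ∑ s ∈ range (j + 1), (∏ k ∈ Ico s (n + 1), (1 - q ^ (2 * (k + 1)))) *
          (∏ k ∈ range s, (1 - q ^ (2 * k + 1))) * q ^ (s * (2 * (n + 1) + 1)) =
        (1 - q ^ (2 * n + 1)) * ∑ s ∈ range (j + 1), (∏ k ∈ Ico s n, (1 - q ^ (2 * (k + 1)))) *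
          (∏ k ∈ range s, (1 - q ^ (2 * k + 1))) * q ^ (s * (2 * n + 1)) +
        (∏ k ∈ Ico j n, (1 - q ^ (2 * (k + 1)))) *
          (∏ k ∈ range (j + 1), (1 - q ^ (2 * k + 1))) * q ^ ((j + 1) * (2 * n + 1)) := by
      intro j
      induction j with
      | zero =>
        intro _
        simp only [zero_add, sum_range_one, prod_range_one, prod_range_zero]
        rw [prod_Ico_succ_top (Nat.zero_le n)]
        ring
      | succ j ihj =>
        intro hj
        rw [sum_range_succ, ihj (by omega), sum_range_succ _ (j + 1),
          prod_Ico_succ_top (by omega : j + 1 ≤ n), prod_eq_prod_Ico_succ_bot (by omega : j < n),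
          prod_range_succ _ (j + 1)]
        ring
    rw [key n le_rfl, sum_range_succ, sum_range_succ, ← ih, prod_range_succ, Ico_self, prod_empty]
    ring

theorem prod_one_sub_odd_mul_prod_one_sub_even (q : R) (n : ℕ) :
    (∏ k ∈ range n, (1 - q ^ (2 * k + 1))) * ∏ k ∈ range n, (1 - q ^ (2 * (k + 1))) =
      ∏ k ∈ range (2 * n), (1 - q ^ (k + 1)) := by
  induction n with
  | zero => simp
  | succ n ih =>
    rw [show 2 * (n + 1) = 2 * n + 1 + 1 by ring, prod_range_succ _ (2 * n + 1),
      prod_range_succ _ (2 * n), ← ih, prod_range_succ, prod_range_succ]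
    ring

end GaussFinite

/-! ### Euler products and Gauss' product formulas -/

section Theta

open PowerSeries Finset Filter
open scoped PowerSeries.WithPiTopology Topology

/-- The Euler product `∏ (1 - q ^ (j * k))` over `k ≥ 1`, for `j ≥ 1`. -/
noncomputable def eulerSeries (j : ℕ) [NeZero j] : ℤ⟦X⟧ :=
  expand j (NeZero.ne j) (pentagonalSeries ℤ)

theorem continuous_expand (j : ℕ) (hj : j ≠ 0) :
    Continuous (expand j hj : ℤ⟦X⟧ →ₐ[ℤ] ℤ⟦X⟧) := by
  rw [continuous_iff_continuousAt]
  intro f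
  rw [ContinuousAt, WithPiTopology.tendsto_iff_coeff_tendsto]
  intro d
  simp only [coeff_expand]
  split_ifs
  · exact (WithPiTopology.continuous_coeff ℤ _).continuousAt
  · exact tendsto_const_nhds

theorem continuous_evalNegHom : Continuous (evalNegHom : ℤ⟦X⟧ →+* ℤ⟦X⟧) := by
  rw [continuous_iff_continuousAt]
  intro f
  rw [ContinuousAt, WithPiTopology.tendsto_iff_coeff_tendsto]
  intro d
  simp only [evalNegHom, coeff_rescale]
  exact ((WithPiTopology.continuous_coeff ℤ d).continuousAt).const_mul _

theorem hasProd_eulerSeries (j : ℕ) [NeZero j] :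
    HasProd (fun k ↦ (1 - X ^ (j * (k + 1)) : ℤ⟦X⟧)) (eulerSeries j) := by
  have h := (WithPiTopology.hasProd_one_sub_X_pow ℤ).map _ (continuous_expand j (NeZero.ne j))
  refine h.congr_fun fun k ↦ ?_
  simp [pow_mul]

theorem expand_eulerSeries (i j : ℕ) [NeZero i] [NeZero j] [NeZero (i * j)] :
    expand i (NeZero.ne i) (eulerSeries j) = eulerSeries (i * j) :=
  (expand_mul i (NeZero.ne i) j (NeZero.ne j) _).symm

theorem eulerSeries_ne_zero (j : ℕ) [NeZero j] : eulerSeries j ≠ 0 := by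
  intro h
  have h0 := congrArg constantCoeff h
  have : constantCoeff (pentagonalSeries ℤ) = 1 := by
    rw [← coeff_zero_eq_constantCoeff_apply]
    exact (coeff_pentagonalSeries_pentagonal ℤ 0).trans (by simp)
  simp [eulerSeries, this] at h0

/-- Padding with 1 indexes all Euler products by the same k, so that product identities can be
checked factor by factor. -/
theorem hasProd_ite_dvd (j : ℕ) [NeZero j] :
    HasProd (fun k ↦ if j ∣ k + 1 then (1 - X ^ (k + 1) : ℤ⟦X⟧) else 1) (eulerSeries j) := by
  have hj : 0 < j := Nat.pos_of_neZero j
  have hpos (k : ℕ) : 0 < j * (k + 1) := by positivity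
  have hinj : Function.Injective (fun k ↦ j * (k + 1) - 1) := by
    intro a b hab
    have h : j * (a + 1) = j * (b + 1) := by
      have := hpos a
      have := hpos b
      simp only at hab
      omega
    have := Nat.eq_of_mul_eq_mul_left hj h
    omega
  rw [← hinj.hasProd_iff]
  · convert hasProd_eulerSeries j using 2 with k
    have : j * (k + 1) - 1 + 1 = j * (k + 1) := by have := hpos k; omega
    simp [this]
  · intro k hk
    rw [if_neg]
    rintro ⟨c, hc⟩
    refine hk ⟨c - 1, ?_⟩
    have : c ≠ 0 := by rintro rfl; simp at hc
    simp only [Nat.sub_add_cancel (Nat.one_le_iff_ne_zero.2 this)]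
    omega

theorem hasProd_ite_dvd_two_mul (j : ℕ) [NeZero j] :
    HasProd (fun k ↦ if j ∣ k + 1 then (1 - X ^ (2 * (k + 1)) : ℤ⟦X⟧) else 1)
      (eulerSeries (2 * j)) := by
  have h := (hasProd_ite_dvd j).map _ (continuous_expand 2 two_ne_zero)
  rw [expand_eulerSeries] at h
  convert h using 2 with k
  by_cases hk : j ∣ k + 1 <;> simp [hk, pow_mul]

theorem evalNegHom_expand_two (f : ℤ⟦X⟧) :
    evalNegHom (expand 2 two_ne_zero f) = expand 2 two_ne_zero f := by
  ext n
  rw [evalNegHom, coeff_rescale, coeff_expand]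
  split_ifs with h
  · rw [(even_iff_two_dvd.2 h).neg_one_pow, one_mul]
  · simp

/-- Compare factors at n = k + 1: for odd n, (1 + qⁿ)(1 - qⁿ) = 1 - q²ⁿ; for even n the missing 1 -
q²ⁿ comes from E₄. -/
theorem evalNegHom_eulerSeries_one :
    evalNegHom (eulerSeries 1) * eulerSeries 1 * eulerSeries 4 = eulerSeries 2 ^ 3 := by
  have hN := (hasProd_eulerSeries 1).map _ continuous_evalNegHom
  have hL := (hN.mul (hasProd_ite_dvd 1)).mul (hasProd_ite_dvd_two_mul 2)
  have hR := (hasProd_ite_dvd_two_mul 1).mul ((hasProd_ite_dvd 2).mul (hasProd_ite_dvd 2))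
  have h := hL.unique (hR.congr_fun ?_)
  · rw [h]
    ring
  · intro k
    rcases Nat.even_or_odd (k + 1) with hk | hk
    · simp [hk.two_dvd, hk.neg_pow]
      ring
    · have : ¬ 2 ∣ k + 1 := by rwa [← even_iff_two_dvd, Nat.not_even_iff_odd]
      simp [this, hk.neg_pow]
      ring

/-- The squares signed by parity: `∑ (-1) ^ k * q ^ (k ^ 2)` over `k ≥ 1`. -/
def signedSquareSeries : ℤ⟦X⟧ :=
  mk fun n ↦ if n ≠ 0 ∧ IsSquare n then (-1) ^ n else 0

/-- Ramanujan's theta function at a negated argument, `φ(-q)`. -/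
noncomputable def phiNeg : ℤ⟦X⟧ :=
  1 + 2 * signedSquareSeries

/-- Ramanujan's theta function `ψ(q)`, the generating function of the triangular numbers. -/
def psi : ℤ⟦X⟧ :=
  mk fun n ↦ if IsSquare (8 * n + 1) then 1 else 0

theorem tendsto_of_coeff_eq {f : ℕ → ℤ⟦X⟧} {g : ℤ⟦X⟧}
    (h : ∀ d n, d < n → coeff d (f n) = coeff d g) : Tendsto f atTop (𝓝 g) := by
  rw [WithPiTopology.tendsto_iff_coeff_tendsto]
  intro d
  exact tendsto_atTop_of_eventually_const (i₀ := d + 1) fun n hn ↦ h d n hn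

theorem tendsto_signedSquareSeries :
    Tendsto (fun n ↦ ∑ s ∈ range n, (-1) ^ (s + 1) * (X : ℤ⟦X⟧) ^ ((s + 1) ^ 2)) atTop
      (𝓝 signedSquareSeries) := by
  refine tendsto_of_coeff_eq fun d n hdn ↦ ?_
  have hterm (s : ℕ) : coeff d ((-1) ^ (s + 1) * (X : ℤ⟦X⟧) ^ ((s + 1) ^ 2)) =
      if d = (s + 1) ^ 2 then (-1) ^ (s + 1) else 0 := by
    rw [show ((-1) ^ (s + 1) : ℤ⟦X⟧) = C ((-1) ^ (s + 1)) by simp, coeff_C_mul, coeff_X_pow]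
    simp
  simp only [map_sum, hterm, signedSquareSeries, coeff_mk]
  split_ifs with h
  · obtain ⟨h0, r, rfl⟩ := h
    obtain ⟨r, rfl⟩ : ∃ t, r = t + 1 := ⟨r - 1, by
      have : r ≠ 0 := by rintro rfl; simp at h0
      omega⟩
    rw [sum_eq_single r]
    · rw [if_pos (by ring), pow_mul]
      rcases neg_one_pow_eq_or ℤ (r + 1) with h | h
      · simp [h]
      · rw [h, Odd.neg_one_pow]
        by_contra hr
        rw [Nat.not_odd_iff_even] at hr
        rw [hr.neg_one_pow] at h
        norm_num at h
    · intro b _ hb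
      rw [if_neg]
      intro h
      apply hb
      nlinarith [lt_trichotomy b r]
    · intro hr
      rw [mem_range] at hr
      nlinarith
  · refine sum_eq_zero fun s _ ↦ if_neg ?_
    rintro rfl
    exact h ⟨by positivity, IsSquare.sq _⟩

theorem tendsto_psi :
    Tendsto (fun n ↦ ∑ k ∈ range n, ((X : ℤ⟦X⟧) ^ (k * (2 * k + 1)) +
      X ^ ((k + 1) * (2 * k + 1)))) atTop (𝓝 psi) := by
  refine tendsto_of_coeff_eq fun d n hdn ↦ ?_
  simp only [map_sum, map_add, coeff_X_pow, psi, coeff_mk]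
  split_ifs with h
  · obtain ⟨r, hr⟩ := h
    -- The roots 4t + 1 and 4t + 3 of 8d + 1 correspond to d = t(2t + 1) and d = (t + 1)(2t + 1).
    obtain ⟨t, ht⟩ : ∃ t, r = 4 * t + 1 ∨ r = 4 * t + 3 := by
      have hodd : Odd r := by
        have : Odd (r * r) := by rw [← hr]; exact ⟨4 * d, by ring⟩
        exact (Nat.odd_mul.1 this).1
      obtain ⟨c, rfl⟩ := hodd
      exact ⟨c / 2, by omega⟩
    rw [sum_eq_single t]
    · rcases ht with rfl | rfl
      · rw [if_pos (by nlinarith), if_neg (by nlinarith), add_zero]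
      · rw [if_neg (by nlinarith), if_pos (by nlinarith), zero_add]
    · intro b _ hb
      rw [if_neg, if_neg, add_zero]
      · rintro rfl
        apply hb
        have : (4 * b + 3) * (4 * b + 3) = r * r := by rw [← hr]; ring
        have := Nat.mul_self_inj.1 this
        omega
      · rintro rfl
        apply hb
        have : (4 * b + 1) * (4 * b + 1) = r * r := by rw [← hr]; ring
        have := Nat.mul_self_inj.1 this
        omega
    · intro ht'
      rw [mem_range] at ht'
      rcases ht with rfl | rfl <;> nlinarith
  · refine sum_eq_zero fun k _ ↦ ?_
    rw [if_neg, if_neg, add_zero]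
    · rintro rfl
      exact h ⟨4 * k + 3, by ring⟩
    · rintro rfl
      exact h ⟨4 * k + 1, by ring⟩

theorem tendsto_eulerSeries_one :
    Tendsto (fun n ↦ ∏ k ∈ range n, (1 - (X : ℤ⟦X⟧) ^ (k + 1))) atTop (𝓝 (eulerSeries 1)) := by
  simpa using (hasProd_eulerSeries 1).tendsto_prod_nat

theorem coeff_sum_eq_zero_of_X_pow_dvd {f : ℕ → ℤ⟦X⟧} {d n N : ℕ} (hd : d < n)
    (h : ∀ s ∈ range N, X ^ n ∣ f s) : coeff d (∑ s ∈ range N, f s) = 0 :=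
  X_pow_dvd_iff.1 (dvd_sum h) d hd

/-- Gauss' product formula `φ(-q) = ∏ (1 - q ^ k) ^ 2 / (1 - q ^ (2 * k))`. -/
theorem phiNeg_mul_eulerSeries : phiNeg * eulerSeries 2 = eulerSeries 1 ^ 2 := by
  have h2 := (hasProd_eulerSeries 2).tendsto_prod_nat
  have hL := ((tendsto_signedSquareSeries.const_mul 2).const_add 1).mul h2
  -- Only the s = 0 term of the finite identity survives in the limit; the others are divisible by
  -- Xⁿ.
  have hrem : Tendsto (fun n ↦ ∑ s ∈ range n, (-1) ^ (s + 1) *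
      (∏ k ∈ Ico (s + 1) n, (1 - (X : ℤ⟦X⟧) ^ (k + 1))) *
        (∏ k ∈ range (s + 1), (1 + X ^ k)) * X ^ ((s + 1) * (n + 1))) atTop (𝓝 0) := by
    refine tendsto_of_coeff_eq fun d n hdn ↦ ?_
    rw [map_zero]
    refine coeff_sum_eq_zero_of_X_pow_dvd hdn fun s _ ↦ Dvd.dvd.mul_left (pow_dvd_pow _ ?_) _
    nlinarith
  have hR := tendsto_eulerSeries_one.mul (tendsto_eulerSeries_one.add hrem)
  rw [add_zero, ← sq] at hR
  refine tendsto_nhds_unique hL (hR.congr fun n ↦ ?_)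
  have h := gauss_square_finite (X : ℤ⟦X⟧) n |>.trans (sum_range_succ' _ n)
  simp only [pow_zero, one_mul, range_zero, prod_empty, mul_one, zero_mul, Nat.Ico_zero_eq_range]
    at h
  have hE : ∏ k ∈ range n, (1 - (X : ℤ⟦X⟧) ^ (2 * (k + 1))) =
      (∏ k ∈ range n, (1 - X ^ (k + 1))) * ∏ k ∈ range n, (1 + X ^ (k + 1)) := by
    rw [← prod_mul_distrib]
    exact prod_congr rfl fun k _ ↦ by ring
  rw [hE]
  linear_combination -(∏ k ∈ range n, (1 - (X : ℤ⟦X⟧) ^ (k + 1))) * h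

/-- Gauss' product formula `ψ(q) = ∏ (1 - q ^ (2 * k)) ^ 2 / (1 - q ^ k)`. -/
theorem psi_mul_eulerSeries : psi * eulerSeries 1 = eulerSeries 2 ^ 2 := by
  have h2 := (hasProd_eulerSeries 2).tendsto_prod_nat
  have hL := tendsto_psi.mul (tendsto_eulerSeries_one.comp (tendsto_id.const_mul_atTop' two_pos))
  have hrem : Tendsto (fun n ↦ ∑ s ∈ range n,
      (∏ k ∈ Ico (s + 1) (n + 1), (1 - (X : ℤ⟦X⟧) ^ (2 * (k + 1)))) *
        (∏ k ∈ range (s + 1), (1 - X ^ (2 * k + 1))) * X ^ ((s + 1) * (2 * (n + 1) + 1)))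
        atTop (𝓝 0) := by
    refine tendsto_of_coeff_eq fun d n hdn ↦ ?_
    rw [map_zero]
    refine coeff_sum_eq_zero_of_X_pow_dvd hdn fun s _ ↦ Dvd.dvd.mul_left (pow_dvd_pow _ ?_) _
    nlinarith
  -- Shifted by one because at n = 0 the finite sum has no s = 0 term to split off.
  have h2' := h2.comp (tendsto_add_atTop_nat 1)
  have hR := h2'.mul (h2'.add hrem)
  rw [add_zero, ← sq] at hR
  refine tendsto_nhds_unique (hL.comp (tendsto_add_atTop_nat 1)) (hR.congr fun n ↦ ?_)
  have h := gauss_triangular_finite (X : ℤ⟦X⟧) (n + 1) |>.trans (sum_range_succ' _ n)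
  simp only [pow_zero, range_zero, prod_empty, mul_one, zero_mul, Nat.Ico_zero_eq_range] at h
  simp only [Function.comp_apply, id]
  rw [← prod_one_sub_odd_mul_prod_one_sub_even]
  linear_combination -(∏ k ∈ range (n + 1), (1 - (X : ℤ⟦X⟧) ^ (2 * (k + 1)))) * h

end Theta

/-! ### The generating function as a theta quotient -/

section SchurSeries

open PowerSeries Finset Filter
open scoped PowerSeries.WithPiTopology Topology

/-- The generating function of the `3`-Schur overpartitions. -/
def schurSeries : ℤ⟦X⟧ :=
  mk fun n ↦ (schurOverpartitionCount 3 n : ℤ)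

/-- A partition with d distinct part sizes has 2^d overlinings: weight 2 per allowed size, 0 per
forbidden one. -/
theorem schurSeries_eq_genFun : schurSeries =
    Nat.Partition.genFun fun i _ ↦ if i % 6 ∈ schurResidues 3 then (2 : ℤ) else 0 := by
  ext n
  rw [schurSeries, coeff_mk, Nat.Partition.coeff_genFun, schurOverpartitionCount,
    schurOverpartitions, card_sigma, sum_filter]
  push_cast
  refine sum_congr rfl fun π _ ↦ ?_
  rw [Finsupp.prod, Multiset.toFinsupp_support]
  split_ifs with h
  · rw [prod_congr rfl fun i hi ↦ if_pos (h i (Multiset.mem_toFinset.1 hi)), prod_const,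
      card_powerset]
    push_cast
    rfl
  · push Not at h
    obtain ⟨a, ha, ha'⟩ := h
    exact (prod_eq_zero (Multiset.mem_toFinset.2 ha) (if_neg ha')).symm

theorem one_add_tsum_two_smul_mul (i : ℕ) :
    (1 + ∑' j, (2 : ℤ) • (X : ℤ⟦X⟧) ^ ((i + 1) * (j + 1))) * (1 - X ^ (i + 1)) =
      1 + X ^ (i + 1) := by
  have h := WithPiTopology.tsum_pow_mul_one_sub_of_constantCoeff_eq_zero
    (f := (X : ℤ⟦X⟧) ^ (i + 1)) (by simp)
  have hs := WithPiTopology.summable_pow_of_constantCoeff_eq_zero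
    (f := (X : ℤ⟦X⟧) ^ (i + 1)) (by simp)
  have ht : ∑' j, (2 : ℤ) • (X : ℤ⟦X⟧) ^ ((i + 1) * (j + 1)) =
      2 * (X ^ (i + 1) * ∑' j, (X ^ (i + 1)) ^ j) := by
    rw [← hs.tsum_mul_left, ← (hs.mul_left _).tsum_mul_left]
    refine tsum_congr fun j ↦ ?_
    rw [pow_mul, pow_succ', zsmul_eq_mul]
    norm_num
  rw [ht]
  linear_combination (2 * X ^ (i + 1)) * h

/-- The comparison of Euler factors at part size n, with T the factor of the generating function; it
depends only on n mod 6. -/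
theorem schur_factor_identity {R : Type*} [CommRing R] {q T : R} {n : ℕ}
    (h₁ : n % 6 = 1 ∨ n % 6 = 5 → T * (1 - q ^ n) = 1 + q ^ n)
    (h₂ : ¬ (n % 6 = 1 ∨ n % 6 = 5) → T = 1) :
    T * (((if 1 ∣ n then 1 - q ^ n else 1) * if 6 ∣ n then 1 - q ^ n else 1) *
        ((if 1 ∣ n then 1 - q ^ n else 1) * if 6 ∣ n then 1 - q ^ n else 1)) *
        (if 2 ∣ n then 1 - q ^ (2 * n) else 1) * (if 3 ∣ n then 1 - q ^ (2 * n) else 1) =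
      ((if 1 ∣ n then 1 - q ^ (2 * n) else 1) * if 6 ∣ n then 1 - q ^ (2 * n) else 1) *
        (((if 2 ∣ n then 1 - q ^ n else 1) * if 3 ∣ n then 1 - q ^ n else 1) *
          ((if 2 ∣ n then 1 - q ^ n else 1) * if 3 ∣ n then 1 - q ^ n else 1)) := by
  have h2 : 2 ∣ n ↔ n % 6 = 0 ∨ n % 6 = 2 ∨ n % 6 = 4 := by omega
  have h3 : 3 ∣ n ↔ n % 6 = 0 ∨ n % 6 = 3 := by omega
  have h6 : 6 ∣ n ↔ n % 6 = 0 := by omega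
  have hr : n % 6 < 6 := Nat.mod_lt _ (by norm_num)
  simp only [h2, h3, h6, one_dvd, if_true, pow_mul' q 2 n]
  generalize n % 6 = r at *
  generalize q ^ n = x at *
  interval_cases r <;> norm_num at h₁ h₂ ⊢ <;> try subst h₂
  · ring
  · linear_combination (1 - x) * h₁
  · ring
  · ring
  · ring
  · linear_combination (1 - x) * h₁

theorem schurSeries_mul_eulerSeries :
    schurSeries * (eulerSeries 1 * eulerSeries 6) ^ 2 * eulerSeries 4 * eulerSeries 6 =
      eulerSeries 2 * eulerSeries 12 * (eulerSeries 2 * eulerSeries 3) ^ 2 := by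
  have hG := Nat.Partition.hasProd_genFun fun i _ ↦
    if i % 6 ∈ schurResidues 3 then (2 : ℤ) else 0
  rw [← schurSeries_eq_genFun] at hG
  have u (j : ℕ) [NeZero j] := hasProd_ite_dvd j
  have v (j : ℕ) [NeZero j] := hasProd_ite_dvd_two_mul j
  have hL := ((hG.mul (((u 1).mul (u 6)).mul ((u 1).mul (u 6)))).mul (v 2)).mul (v 3)
  have hR := ((v 1).mul (v 6)).mul (((u 2).mul (u 3)).mul ((u 2).mul (u 3)))
  have h := hL.unique (hR.congr_fun fun k ↦ ?_)
  · rw [sq, sq]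
    exact h
  · have hI : schurResidues 3 = {1, 5} := by decide
    refine schur_factor_identity (fun h ↦ ?_) fun h ↦ ?_
    · simp only [hI, mem_insert, mem_singleton, h, if_true]
      exact one_add_tsum_two_smul_mul k
    · simp only [hI, mem_insert, mem_singleton, h, if_false, smul_eq_C_mul]
      simp

theorem phiNeg_expand_mul (j : ℕ) [NeZero j] [NeZero (j * 2)] [NeZero (j * 1)] :
    expand j (NeZero.ne j) phiNeg * eulerSeries (j * 2) = eulerSeries (j * 1) ^ 2 := by
  rw [← expand_eulerSeries, ← expand_eulerSeries, ← map_mul, phiNeg_mul_eulerSeries, map_pow]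

/-- The generating function of the `3`-Schur overpartitions as a quotient of theta functions. -/
theorem schurSeries_mul_phiNeg :
    schurSeries * phiNeg * expand 6 (by norm_num) phiNeg =
      expand 2 two_ne_zero phiNeg * expand 3 three_ne_zero phiNeg := by
  have h1 := phiNeg_mul_eulerSeries
  have h2 := phiNeg_expand_mul 2
  have h3 := phiNeg_expand_mul 3
  have h6 := phiNeg_expand_mul 6
  have h := schurSeries_mul_eulerSeries
  simp only [Nat.reduceMul] at h2 h3 h6
  have hne : eulerSeries 2 * eulerSeries 12 * eulerSeries 4 * eulerSeries 6 ≠ 0 :=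
    mul_ne_zero (mul_ne_zero (mul_ne_zero (eulerSeries_ne_zero _) (eulerSeries_ne_zero _))
      (eulerSeries_ne_zero _)) (eulerSeries_ne_zero _)
  refine mul_right_cancel₀ hne ?_
  calc _ = schurSeries * (phiNeg * eulerSeries 2) *
        (expand 6 (by norm_num) phiNeg * eulerSeries 12) * eulerSeries 4 * eulerSeries 6 := by ring
    _ = schurSeries * (eulerSeries 1 * eulerSeries 6) ^ 2 * eulerSeries 4 * eulerSeries 6 := by
      rw [h1, h6]; ring
    _ = eulerSeries 2 * eulerSeries 12 * (eulerSeries 2 * eulerSeries 3) ^ 2 := h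
    _ = eulerSeries 2 * eulerSeries 12 * (expand 2 two_ne_zero phiNeg * eulerSeries 4) *
        (expand 3 three_ne_zero phiNeg * eulerSeries 6) := by rw [h2, h3]; ring
    _ = _ := by ring

end SchurSeries

/-! ### Reduction modulo 8 -/

section ModEight

open PowerSeries Finset

/-- Frobenius fixes the coefficients in `ZMod p`. -/
theorem pow_eq_expand (p : ℕ) [Fact p.Prime] (f : (ZMod p)⟦X⟧) :
    f ^ p = expand p (NeZero.ne p) f := by
  have h := MvPowerSeries.map_frobenius_expand p (NeZero.ne p) (f := f)
  rw [ZMod.frobenius_zmod, MvPowerSeries.map_id] at h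
  exact h.symm

theorem two_dvd_sq_sub_expand (f : ℤ⟦X⟧) : (2 : ℤ⟦X⟧) ∣ f ^ 2 - expand 2 two_ne_zero f := by
  have h2 : map (Int.castRingHom (ZMod 2)) (f ^ 2 - expand 2 two_ne_zero f) = 0 := by
    rw [map_sub, map_pow, map_expand, sub_eq_zero]
    exact (pow_eq_expand 2 _)
  refine ⟨mk fun n ↦ coeff n (f ^ 2 - expand 2 two_ne_zero f) / 2, ?_⟩
  ext n
  have h := congrArg (coeff n) h2
  rw [coeff_map, map_zero, eq_intCast, ZMod.intCast_zmod_eq_zero_iff_dvd] at h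
  rw [show (2 : ℤ⟦X⟧) = C 2 from rfl, coeff_C_mul, coeff_mk]
  exact (Int.mul_ediv_cancel' h).symm

theorem dvd_coeff_of_C_dvd {c : ℤ} {f : ℤ⟦X⟧} (h : (C c : ℤ⟦X⟧) ∣ f) (n : ℕ) : c ∣ coeff n f := by
  obtain ⟨g, rfl⟩ := h
  rw [coeff_C_mul]
  exact dvd_mul_right _ _

theorem coeff_expand_signedSquareSeries_eq_zero {j N : ℕ} (hj : j ≠ 0)
    (h : ∀ x : ℕ, j * x ^ 2 ≠ N) : coeff N (expand j hj signedSquareSeries) = 0 := by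
  rw [coeff_expand]
  split_ifs with hd
  · rw [signedSquareSeries, coeff_mk, if_neg]
    rintro ⟨-, x, hx⟩
    exact h x (by rw [sq, ← hx, Nat.mul_div_cancel' hd])
  · rfl

theorem coeff_expand_mul_expand_signedSquareSeries_eq_zero {i j N : ℕ} (hi : i ≠ 0) (hj : j ≠ 0)
    (h : ∀ x y : ℕ, i * x ^ 2 + j * y ^ 2 ≠ N) :
    coeff N (expand i hi signedSquareSeries * expand j hj signedSquareSeries) = 0 := by
  rw [coeff_mul]
  refine sum_eq_zero fun uv huv ↦ ?_
  rw [HasAntidiagonal.mem_antidiagonal] at huv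
  by_contra hne
  obtain ⟨h1, h2⟩ := ne_zero_and_ne_zero_of_mul hne
  have h1' := mt (coeff_expand_signedSquareSeries_eq_zero hi) h1
  have h2' := mt (coeff_expand_signedSquareSeries_eq_zero hj) h2
  push Not at h1' h2'
  obtain ⟨x, hx⟩ := h1'
  obtain ⟨y, hy⟩ := h2'
  exact h x y (by rw [hx, hy, huv])

/-- Modulo `8`, the coefficients of the generating function of the `3`-Schur overpartitions are
governed by representation numbers of unary and binary quadratic forms. -/
theorem schurSeries_modEq_eight :
    (C 8 : ℤ⟦X⟧) ∣ schurSeries - (1 + 2 * (expand 2 two_ne_zero signedSquareSeries +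
      expand 3 three_ne_zero signedSquareSeries - expand 1 one_ne_zero signedSquareSeries -
      expand 6 (by norm_num) signedSquareSeries) +
      4 * (expand 2 two_ne_zero signedSquareSeries +
        expand 12 (by norm_num) signedSquareSeries +
        expand 2 two_ne_zero signedSquareSeries * expand 3 three_ne_zero signedSquareSeries -
        expand 1 one_ne_zero signedSquareSeries * expand 2 two_ne_zero signedSquareSeries -
        expand 2 two_ne_zero signedSquareSeries * expand 6 (by norm_num) signedSquareSeries -
        expand 1 one_ne_zero signedSquareSeries * expand 3 three_ne_zero signedSquareSeries -
        expand 3 three_ne_zero signedSquareSeries * expand 6 (by norm_num) signedSquareSeries +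
        expand 1 one_ne_zero signedSquareSeries *
          expand 6 (by norm_num) signedSquareSeries)) := by
  have h := schurSeries_mul_phiNeg
  obtain ⟨c, hc⟩ := two_dvd_sq_sub_expand signedSquareSeries
  have hc6 := congrArg (expand 6 (by norm_num)) hc
  rw [map_sub, map_pow, ← expand_mul, map_mul, map_ofNat] at hc6
  simp only [phiNeg, map_add, map_mul, map_one, map_ofNat, Nat.reduceMul] at h hc6
  rw [expand_one_apply]
  generalize expand 6 _ c = c6 at *
  generalize expand 12 _ signedSquareSeries = a12 at *
  generalize expand 6 _ signedSquareSeries = a6 at *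
  generalize expand 3 _ signedSquareSeries = a3 at *
  generalize expand 2 _ signedSquareSeries = a2 at *
  generalize signedSquareSeries = a at *
  generalize schurSeries = G at *
  rw [show (C 8 : ℤ⟦X⟧) = 8 from rfl]
  -- The inverses mod 8 come from (1 + 2a)(1 - 2a + 4a²) = 1 + 8a³.
  obtain ⟨d, hd⟩ : (8 : ℤ⟦X⟧) ∣ G - (1 + 2 * a2) * (1 + 2 * a3) * (1 - 2 * a + 4 * a ^ 2) *
      (1 - 2 * a6 + 4 * a6 ^ 2) :=
    ⟨-G * (a ^ 3 + a6 ^ 3 + 8 * a ^ 3 * a6 ^ 3), by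
      linear_combination (1 - 2 * a + 4 * a ^ 2) * (1 - 2 * a6 + 4 * a6 ^ 2) * h⟩
  rw [sub_eq_iff_eq_add] at hc hc6 hd
  refine ⟨d + a2 * a3 * (1 - a + 2 * a * a6 - 8 * a * c6 - 4 * a * a12 + 4 * c - 8 * c * a6 +
      32 * c * c6 + 16 * c * a12 - 3 * a6 + 12 * c6 + 6 * a12) +
    a2 * (a * a6 - 4 * a * c6 - 2 * a * a12 + 2 * c - 4 * c * a6 + 16 * c * c6 + 8 * c * a12 -
      a6 + 6 * c6 + 3 * a12) +
    a2 ^ 2 * (1 + 2 * a3 - 4 * a3 * a6 + 16 * a3 * c6 + 8 * a3 * a12 - 2 * a6 + 8 * c6 +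
      4 * a12) +
    a3 * (a * a6 - 4 * a * c6 - 2 * a * a12 + 2 * c - 4 * c * a6 + 16 * c * c6 + 8 * c * a12 +
      2 * c6 + a12) - 2 * a * c6 - a * a12 + c - 2 * c * a6 + 8 * c * c6 + 4 * c * a12 + c6, ?_⟩
  rw [hd, hc, hc6]
  ring

end ModEight

/-! ### 2-dissections of φ and its square -/

section ThetaDissection

open PowerSeries Finset
open scoped PowerSeries.WithPiTopology

theorem expand_injective {R : Type*} [CommRing R] {p : ℕ} (hp : p ≠ 0) :
    Function.Injective (expand p hp : R⟦X⟧ →ₐ[R] R⟦X⟧) := by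
  intro f g h
  ext n
  rw [← coeff_expand_mul p hp f, h, coeff_expand_mul]

/-- Ramanujan's theta function `φ(q)`. -/
noncomputable def phi : ℤ⟦X⟧ :=
  evalNegHom phiNeg

theorem coeff_phiNeg (n : ℕ) : coeff n phiNeg =
    if n = 0 then 1 else if IsSquare n then 2 * (-1) ^ n else 0 := by
  rw [phiNeg, show (2 : ℤ⟦X⟧) = C 2 from rfl, map_add, coeff_C_mul, coeff_one, signedSquareSeries,
    coeff_mk]
  split_ifs <;> simp_all

theorem coeff_phi (n : ℕ) : coeff n phi =
    if n = 0 then 1 else if IsSquare n then 2 else 0 := by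
  rw [phi, evalNegHom, coeff_rescale, coeff_phiNeg]
  split_ifs with h₁ h₂
  · simp [h₁]
  · rw [mul_left_comm, ← mul_pow]
    simp
  · simp

/-- After multiplication by E₂²E₄² both sides are E₂⁶. This turns denominators φ(-q) into series in
q², which dissection can pass through. -/
theorem phi_mul_phiNeg : phi * phiNeg = expand 2 two_ne_zero phiNeg ^ 2 := by
  have h1 := phiNeg_mul_eulerSeries
  have h2 := phiNeg_expand_mul 2
  simp only [Nat.reduceMul] at h2
  have h3 : phi * eulerSeries 2 = evalNegHom (eulerSeries 1) ^ 2 := by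
    have hN : evalNegHom (eulerSeries 2) = eulerSeries 2 := evalNegHom_expand_two _
    rw [← map_pow, ← h1, map_mul, hN, phi]
  have h4 := evalNegHom_eulerSeries_one
  have hne : eulerSeries 2 ^ 2 * eulerSeries 4 ^ 2 ≠ 0 :=
    mul_ne_zero (pow_ne_zero _ (eulerSeries_ne_zero _)) (pow_ne_zero _ (eulerSeries_ne_zero _))
  refine mul_right_cancel₀ hne ?_
  calc _ = (phi * eulerSeries 2) * (phiNeg * eulerSeries 2) * eulerSeries 4 ^ 2 := by ring
    _ = (evalNegHom (eulerSeries 1) * eulerSeries 1 * eulerSeries 4) ^ 2 := by rw [h1, h3]; ring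
    _ = (eulerSeries 2 ^ 2) ^ 2 * eulerSeries 2 ^ 2 := by rw [h4]; ring
    _ = _ := by rw [← h2]; ring

theorem isSquare_four_mul_iff {t : ℕ} : IsSquare (4 * t) ↔ IsSquare t := by
  constructor
  · rintro ⟨r, hr⟩
    have : Even (r * r) := ⟨2 * t, by omega⟩
    obtain ⟨s, rfl⟩ : Even r := by simpa [Nat.even_mul] using this
    exact ⟨s, by nlinarith⟩
  · rintro ⟨r, rfl⟩
    exact ⟨2 * r, by ring⟩

theorem mod_eight_of_isSquare_of_odd {n : ℕ} (h : IsSquare n) (hn : n % 2 = 1) : n % 8 = 1 := by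
  obtain ⟨r, rfl⟩ := h
  obtain ⟨c, rfl⟩ : Odd r := (Nat.odd_mul.1 (Nat.odd_iff.2 hn)).1
  obtain ⟨d, hd⟩ := Nat.even_mul_succ_self c
  rw [show (2 * c + 1) * (2 * c + 1) = 4 * (c * (c + 1)) + 1 by ring, hd]
  omega

theorem not_isSquare_of_mod_four_eq_two {n : ℕ} (hn : n % 4 = 2) : ¬ IsSquare n := by
  rintro ⟨r, rfl⟩
  rcases Nat.even_or_odd' r with ⟨c, rfl | rfl⟩
  · have : 2 * c * (2 * c) = 4 * (c * c) := by ring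
    omega
  · have : (2 * c + 1) * (2 * c + 1) = 4 * (c * c + c) + 1 := by ring
    omega

/-- The `2`-dissection of `φ(-q)`. -/
theorem phiNeg_dissection :
    phiNeg = expand 4 four_ne_zero phi - 2 * (X * expand 8 (by norm_num) psi) := by
  ext n
  rw [map_sub, show (2 : ℤ⟦X⟧) = C 2 from rfl, coeff_C_mul, coeff_phiNeg, coeff_expand, coeff_phi]
  rcases n with _ | k
  · simp
  rw [coeff_succ_X_mul, coeff_expand, psi, coeff_mk, if_neg (Nat.succ_ne_zero k)]
  -- Even squares are 4 times a square and feed φ(q⁴); odd squares are 1 mod 8 and feed qψ(q⁸).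
  have hmod : (k + 1) % 4 = 0 ∨ (k + 1) % 4 = 2 ∨ (k + 1) % 2 = 1 := by omega
  rcases hmod with h | h | h
  · obtain ⟨t, ht⟩ : 4 ∣ k + 1 := Nat.dvd_of_mod_eq_zero h
    have h8 : ¬ 8 ∣ k := by omega
    have ht0 : t ≠ 0 := by omega
    have he : Even (4 * t) := ⟨2 * t, by ring⟩
    rw [ht, if_neg h8, if_pos (dvd_mul_right 4 t), Nat.mul_div_cancel_left _ four_pos, if_neg ht0]
    simp [isSquare_four_mul_iff, he.neg_one_pow]
  · have h8 : ¬ 8 ∣ k := by omega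
    have h4 : ¬ 4 ∣ k + 1 := by omega
    simp [h8, h4, not_isSquare_of_mod_four_eq_two h]
  · have h4 : ¬ 4 ∣ k + 1 := by omega
    have ho : (-1 : ℤ) ^ (k + 1) = -1 := (Nat.odd_iff.2 h).neg_one_pow
    rw [if_neg h4, ho]
    by_cases h8 : 8 ∣ k
    · rw [if_pos h8, Nat.mul_div_cancel' h8]
      split_ifs <;> simp
    · rw [if_neg h8, if_neg fun hs ↦ h8 ?_]
      · simp
      · have := mod_eight_of_isSquare_of_odd hs h
        omega

theorem phi_dissection :
    phi = expand 4 four_ne_zero phi + 2 * (X * expand 8 (by norm_num) psi) := by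
  have h4 (f : ℤ⟦X⟧) : evalNegHom (expand 4 four_ne_zero f) = expand 4 four_ne_zero f := by
    rw [show expand 4 four_ne_zero f = _ from expand_mul 2 two_ne_zero 2 two_ne_zero f,
      evalNegHom_expand_two]
  have h8 (f : ℤ⟦X⟧) :
      evalNegHom (expand 8 (by norm_num) f) = expand 8 (by norm_num) f := by
    rw [show expand 8 (by norm_num) f = _ from expand_mul 2 two_ne_zero 4 four_ne_zero f,
      evalNegHom_expand_two]
  conv_lhs => rw [phi, phiNeg_dissection]
  rw [map_sub, h4, map_mul, map_mul, map_ofNat, h8, evalNegHom_X]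
  ring

/-- The `2`-dissection of `φ(-q) ^ 2`. -/
theorem phiNeg_sq_dissection :
    phiNeg ^ 2 = expand 2 two_ne_zero (phi ^ 2) -
      4 * (X * expand 2 two_ne_zero (expand 2 two_ne_zero psi ^ 2)) := by
  have h4 : expand 4 four_ne_zero phi = expand 2 two_ne_zero (expand 2 two_ne_zero phi) :=
    expand_mul 2 two_ne_zero 2 two_ne_zero phi
  have h8 : expand 8 (by norm_num) psi =
      expand 2 two_ne_zero (expand 2 two_ne_zero (expand 2 two_ne_zero psi)) :=
    (expand_mul 2 two_ne_zero 4 four_ne_zero psi).trans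
      (congrArg _ (expand_mul 2 two_ne_zero 2 two_ne_zero psi))
  have hm := phiNeg_dissection
  have hp := phi_dissection
  rw [h4, h8] at hm hp
  -- After q ↦ q², the left side is φ(q)φ(-q) = (A + 2B)(A - 2B) with A = φ(q⁴), B = qψ(q⁸).
  apply expand_injective two_ne_zero
  simp only [map_sub, map_mul, map_pow, map_ofNat, expand_X]
  linear_combination -phi_mul_phiNeg + phiNeg * hp +
    (expand 2 two_ne_zero (expand 2 two_ne_zero phi) + 2 * (X * expand 2 two_ne_zero
      (expand 2 two_ne_zero (expand 2 two_ne_zero psi)))) * hm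

/-- The `2`-dissection of `φ(q) ^ 2`. -/
theorem phi_sq_dissection :
    phi ^ 2 = expand 2 two_ne_zero (phi ^ 2) +
      4 * (X * expand 2 two_ne_zero (expand 2 two_ne_zero psi ^ 2)) := by
  conv_lhs => rw [phi, ← map_pow, phiNeg_sq_dissection]
  rw [map_sub, map_mul, map_mul, map_ofNat, evalNegHom_expand_two, evalNegHom_expand_two,
    evalNegHom_X]
  ring

/-- Supplies the cube that completes the argument mod 3. -/
theorem psi_sq_mul_phiNeg : psi ^ 2 * phiNeg = eulerSeries 2 ^ 3 := by
  have hne : eulerSeries 1 ^ 2 * eulerSeries 2 ≠ 0 :=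
    mul_ne_zero (pow_ne_zero _ (eulerSeries_ne_zero _)) (eulerSeries_ne_zero _)
  refine mul_right_cancel₀ hne ?_
  calc _ = (psi * eulerSeries 1) ^ 2 * (phiNeg * eulerSeries 2) := by ring
    _ = _ := by rw [psi_mul_eulerSeries, phiNeg_mul_eulerSeries]; ring

end ThetaDissection

/-! ### Divisibility by 3 -/

section ModThree

open PowerSeries Finset

variable {R : Type*} [CommRing R]

/-- The series `∑ a (2 * n + r) * q ^ n` extracted from `∑ a n * q ^ n`. -/
noncomputable def dissect (r : ℕ) (f : R⟦X⟧) : R⟦X⟧ :=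
  mk fun n ↦ coeff (2 * n + r) f

theorem dissect_zero_eq {f a b : R⟦X⟧}
    (h : f = expand 2 two_ne_zero a + X * expand 2 two_ne_zero b) : dissect 0 f = a := by
  ext n
  rw [dissect, coeff_mk, h, map_add, add_zero, coeff_expand_mul, add_eq_left]
  rcases n with _ | n
  · simp
  · rw [show 2 * (n + 1) = 2 * n + 1 + 1 by ring, coeff_succ_X_mul,
      coeff_expand_of_not_dvd 2 _ _ (by omega)]

theorem dissect_one_eq {f a b : R⟦X⟧}
    (h : f = expand 2 two_ne_zero a + X * expand 2 two_ne_zero b) : dissect 1 f = b := by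
  ext n
  rw [dissect, coeff_mk, h, map_add, coeff_succ_X_mul, coeff_expand_mul,
    coeff_expand_of_not_dvd 2 _ _ (by omega), zero_add]

theorem eq_expand_dissect_add (f : R⟦X⟧) :
    f = expand 2 two_ne_zero (dissect 0 f) + X * expand 2 two_ne_zero (dissect 1 f) := by
  ext n
  rw [map_add]
  rcases Nat.even_or_odd' n with ⟨c, rfl | rfl⟩
  · rw [coeff_expand_mul, dissect, coeff_mk, add_zero, left_eq_add]
    rcases c with _ | c
    · simp
    · rw [show 2 * (c + 1) = 2 * c + 1 + 1 by ring, coeff_succ_X_mul,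
        coeff_expand_of_not_dvd 2 _ _ (by omega)]
  · rw [coeff_succ_X_mul, coeff_expand_mul, coeff_expand_of_not_dvd 2 _ _ (by omega), dissect,
      coeff_mk, zero_add]

/-- A factor in q² does not mix parities, so it passes through the extraction. -/
theorem dissect_zero_mul {f g a b : R⟦X⟧}
    (h : f * expand 2 two_ne_zero g = expand 2 two_ne_zero a + X * expand 2 two_ne_zero b) :
    dissect 0 f * g = a := by
  rw [← dissect_zero_eq h]
  refine (dissect_zero_eq (b := dissect 1 f * g) ?_).symm
  conv_lhs => rw [eq_expand_dissect_add f]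
  rw [map_mul, map_mul]
  ring

theorem dissect_one_mul {f g a b : R⟦X⟧}
    (h : f * expand 2 two_ne_zero g = expand 2 two_ne_zero a + X * expand 2 two_ne_zero b) :
    dissect 1 f * g = b := by
  rw [← dissect_one_eq h]
  refine (dissect_one_eq (a := dissect 0 f * g) ?_).symm
  conv_lhs => rw [eq_expand_dissect_add f]
  rw [map_mul, map_mul]
  ring

/-- Derivatives of p-th powers vanish in characteristic p, so f' = 0 and n times the n-th
coefficient is zero. -/
theorem coeff_eq_zero_of_mul_pow_eq_pow {p : ℕ} [Fact p.Prime] {f g h : (ZMod p)⟦X⟧}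
    (hg : g ≠ 0) (hfg : f * g ^ p = h ^ p) {n : ℕ} (hn : ¬ p ∣ n) : coeff n f = 0 := by
  have hpow (u : (ZMod p)⟦X⟧) : d⁄dX (ZMod p) (u ^ p) = 0 := by
    rw [derivative_pow, ← map_natCast (C (R := ZMod p)), CharP.cast_eq_zero]
    simp
  have hd := congrArg (d⁄dX (ZMod p)) hfg
  rw [Derivation.leibniz, hpow, hpow, smul_zero, zero_add, smul_eq_mul, mul_eq_zero] at hd
  have hf := hd.resolve_left (pow_ne_zero _ hg)
  obtain ⟨k, rfl⟩ : ∃ k, n = k + 1 := ⟨n - 1, by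
    have : n ≠ 0 := by rintro rfl; simp at hn
    omega⟩
  have hc := congrArg (coeff k) hf
  rw [coeff_derivative, map_zero, mul_eq_zero] at hc
  refine hc.resolve_right fun h0 ↦ hn ?_
  rw [← ZMod.natCast_eq_zero_iff]
  exact_mod_cast h0

theorem three_dvd_schurOverpartitionCount {n : ℕ} (hn : ¬ 3 ∣ n) :
    3 ∣ schurOverpartitionCount 3 (8 * n + 2) := by
  have : Fact (Nat.Prime 3) := ⟨Nat.prime_three⟩
  have h3 : (3 : (ZMod 3)⟦X⟧) = 0 := by
    rw [show (3 : (ZMod 3)⟦X⟧) = C 3 from rfl, show (3 : ZMod 3) = 0 from rfl, map_zero]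
  set r := map (Int.castRingHom (ZMod 3)) with hr
  set e := (expand 2 two_ne_zero : (ZMod 3)⟦X⟧ →ₐ[ZMod 3] (ZMod 3)⟦X⟧) with he
  have hre (f : ℤ⟦X⟧) : r (expand 2 two_ne_zero f) = e (r f) := map_expand 2 two_ne_zero _ f
  have hX : r X = X := map_X _
  have hM0 : r phiNeg ≠ 0 := by
    intro h
    have := congrArg (coeff 0) h
    rw [hr, coeff_map, coeff_phiNeg] at this
    simp at this
  have hPM : r phi * r phiNeg = e (r phiNeg) ^ 2 := by
    rw [← hre, ← map_mul, ← map_pow, phi_mul_phiNeg]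
  have hP : r phi ^ 2 = e (r phi ^ 2) + X * e (e (r psi) ^ 2) := by
    have h := congrArg r phi_sq_dissection
    simp only [map_add, map_mul, map_pow, map_ofNat, hre, hX] at h ⊢
    linear_combination h + X * e (e (r psi)) ^ 2 * h3
  have hM : r phiNeg ^ 2 = e (r phi ^ 2) + X * e (-e (r psi) ^ 2) := by
    have h := congrArg r phiNeg_sq_dissection
    simp only [map_sub, map_mul, map_pow, map_ofNat, hre, hX, map_neg] at h ⊢
    linear_combination h - X * e (e (r psi)) ^ 2 * h3
  have hG : r schurSeries * e (r phiNeg ^ 2) = r phiNeg ^ 2 := by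
    have h := congrArg r schurSeries_mul_phiNeg
    rw [show expand 6 _ phiNeg = _ from expand_mul 2 two_ne_zero 3 three_ne_zero phiNeg] at h
    have hr3 : r (expand 3 three_ne_zero phiNeg) = r phiNeg ^ 3 := by
      rw [pow_eq_expand]
      exact map_expand 3 three_ne_zero _ phiNeg
    simp only [map_mul, hre, hr3, map_pow] at h ⊢
    have he0 : e (r phiNeg) ≠ 0 := fun h0 ↦
      hM0 (expand_injective two_ne_zero (h0.trans (map_zero _).symm))
    refine mul_right_cancel₀ (mul_ne_zero hM0 he0) ?_
    linear_combination h
  have heX : e X = X ^ 2 := expand_X 2 two_ne_zero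
  set F := dissect 0 (r schurSeries) with hF
  have hG0 : F * r phiNeg ^ 2 = r phi ^ 2 := dissect_zero_mul (hG.trans hM)
  set F₁ := dissect 1 F with hF₁
  -- Multiplying `hG0` by φ(q)² gives F φ(-q²)⁴ = φ(q)⁴. The odd part comes from the cross term of
  -- the square of `hP`, and 2 = -1.
  have hG1 : F₁ * r phiNeg ^ 4 =
      -(r phi ^ 2 * e (r psi) ^ 2) := by
    refine dissect_one_mul (a := r phi ^ 4 + X * e (r psi) ^ 4) ?_
    rw [← he]
    simp only [map_add, map_mul, map_pow, map_neg, heX] at hP ⊢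
    linear_combination -F * (r phi * r phiNeg + e (r phiNeg) ^ 2) * hPM + r phi ^ 2 * hG0 +
      (r phi ^ 2 + (e (r phi) ^ 2 + X * e (e (r psi)) ^ 2)) * hP +
      X * e (r phi) ^ 2 * e (e (r psi)) ^ 2 * h3
  -- Multiplying by φ(q)⁴ creates φ(q)⁶, the cube of `hP`; mod 3 only the two pure cubes remain, one
  -- in each parity.
  have hG2 : dissect 0 F₁ * r phiNeg ^ 8 =
      -(r phi ^ 6 * r psi ^ 2) := by
    refine dissect_zero_mul (b := -X * e (r psi) ^ 6 * r psi ^ 2) ?_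
    rw [← he]
    simp only [map_mul, map_pow, map_neg, heX] at hP ⊢
    linear_combination -F₁ * (r phi * r phiNeg + e (r phiNeg) ^ 2) *
        ((r phi * r phiNeg) ^ 2 + e (r phiNeg) ^ 4) * hPM + r phi ^ 4 * hG1 -
      e (r psi) ^ 2 * (r phi ^ 4 + r phi ^ 2 * (e (r phi) ^ 2 + X * e (e (r psi)) ^ 2) +
        (e (r phi) ^ 2 + X * e (e (r psi)) ^ 2) ^ 2) * hP -
      e (r psi) ^ 2 * (X * e (r phi) ^ 4 * e (e (r psi)) ^ 2 +
        X ^ 2 * e (r phi) ^ 2 * e (e (r psi)) ^ 4) * h3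
  have hc := coeff_eq_zero_of_mul_pow_eq_pow
    (f := dissect 0 F₁) (g := r phiNeg ^ 3)
    (h := -(r phi ^ 2 * r (eulerSeries 2))) (pow_ne_zero _ hM0) (by
      have h := congrArg r psi_sq_mul_phiNeg
      simp only [map_mul, map_pow] at h
      linear_combination r phiNeg * hG2 - r phi ^ 6 * h) hn
  simp only [hF₁, hF, dissect, coeff_mk, hr, coeff_map, schurSeries, add_zero] at hc
  rw [show 2 * (2 * (2 * n) + 1) = 8 * n + 2 by ring] at hc
  rw [← ZMod.natCast_eq_zero_iff]
  exact_mod_cast hc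

end ModThree

/-! ### Excluding the quadratic forms -/

section Representation

open PowerSeries

theorem exists_eq_mul_of_dvd_sq_add_six_mul_sq {p : ℕ} [Fact p.Prime]
    (hleg : legendreSym p (-6) = -1) {x y : ℕ} (h : p ∣ x ^ 2 + 6 * y ^ 2) :
    ∃ a b, p * a = x ∧ p * b = y := by
  have h' : (p : ℤ) ∣ (x : ℤ) ^ 2 - -6 * (y : ℤ) ^ 2 := by
    rw [neg_mul, sub_neg_eq_add]
    exact_mod_cast h
  obtain ⟨hx, hy⟩ := legendreSym.prime_dvd_of_eq_neg_one hleg h'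
  obtain ⟨a, ha⟩ := Int.natCast_dvd_natCast.1 hx
  obtain ⟨b, hb⟩ := Int.natCast_dvd_natCast.1 hy
  exact ⟨a, b, ha.symm, hb.symm⟩

/-- A number exactly divisible by an odd power of `p` is not of the form `x ^ 2 + 6 * y ^ 2`
when `-6` is a quadratic nonresidue modulo `p`. -/
theorem sq_add_six_mul_sq_ne {p : ℕ} [Fact p.Prime] (hleg : legendreSym p (-6) = -1) {v : ℕ}
    (hv : ¬ p ∣ v) (α : ℕ) (x y : ℕ) : x ^ 2 + 6 * y ^ 2 ≠ p ^ (2 * α + 1) * v := by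
  have hp : 0 < p := (Fact.out : p.Prime).pos
  induction α generalizing x y with
  | zero =>
    intro h
    obtain ⟨a, b, rfl, rfl⟩ := exists_eq_mul_of_dvd_sq_add_six_mul_sq hleg (x := x) (y := y)
      ⟨v, by rw [h]; ring⟩
    refine hv ⟨a ^ 2 + 6 * b ^ 2, ?_⟩
    refine Nat.eq_of_mul_eq_mul_left hp ?_
    calc p * v = (p * a) ^ 2 + 6 * (p * b) ^ 2 := by rw [h]; ring
      _ = _ := by ring
  | succ α ih =>
    intro h
    obtain ⟨a, b, rfl, rfl⟩ := exists_eq_mul_of_dvd_sq_add_six_mul_sq hleg (x := x) (y := y)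
      ⟨p ^ (2 * α + 2) * v, by rw [h]; ring⟩
    refine ih a b ?_
    refine Nat.eq_of_mul_eq_mul_left (pow_pos hp 2) ?_
    linear_combination h

/-- N is 10 mod 16 and 1 mod 3, which rules out every form in the mod 8 expansion except x² + 6y².
-/
theorem eight_dvd_schurOverpartitionCount {N : ℕ} (hN : N % 48 = 10)
    (hrep : ∀ x y : ℕ, x ^ 2 + 6 * y ^ 2 ≠ N) : 8 ∣ schurOverpartitionCount 3 N := by
  have h16 : (N : ZMod 16) = 10 := by
    rw [← Nat.div_add_mod N 48, hN]
    push_cast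
    rw [show (48 : ZMod 16) = 0 from rfl, zero_mul, zero_add]
  have h3 : (N : ZMod 3) = 1 := by
    rw [← Nat.div_add_mod N 48, hN]
    push_cast
    rw [show (48 : ZMod 3) = 0 from rfl, zero_mul, zero_add]
    rfl
  have h := dvd_coeff_of_C_dvd schurSeries_modEq_eight N
  have ne16 {i j : ℕ} (hij : ∀ a b : ZMod 16, i * a ^ 2 + j * b ^ 2 ≠ 10) (x y : ℕ) :
      i * x ^ 2 + j * y ^ 2 ≠ N := fun he ↦ hij x y (by rw [← h16, ← he]; push_cast; rfl)
  have ne3 {i j : ℕ} (hij : ∀ a b : ZMod 3, i * a ^ 2 + j * b ^ 2 ≠ 1) (x y : ℕ) :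
      i * x ^ 2 + j * y ^ 2 ≠ N := fun he ↦ hij x y (by rw [← h3, ← he]; push_cast; rfl)
  have unary {i j : ℕ} (hij : ∀ x y : ℕ, i * x ^ 2 + j * y ^ 2 ≠ N) (x : ℕ) : i * x ^ 2 ≠ N := by
    simpa using hij x 0
  have h12 := ne16 (i := 1) (j := 2) (by decide)
  have h13 := ne16 (i := 1) (j := 3) (by decide)
  have h23 := ne16 (i := 2) (j := 3) (by decide)
  have h26 := ne3 (i := 2) (j := 6) (by decide)
  have h36 := ne3 (i := 3) (j := 6) (by decide)
  -- With j = 0 the second variable is a dummy, which covers the unary forms.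
  have h60 := ne3 (i := 6) (j := 0) (by decide)
  have h120 := ne3 (i := 12) (j := 0) (by decide)
  have hN0 : N ≠ 0 := by omega
  simp only [show (2 : ℤ⟦X⟧) = C 2 from rfl, show (4 : ℤ⟦X⟧) = C 4 from rfl, map_add, map_sub,
    coeff_C_mul, coeff_one, if_neg hN0,
    coeff_expand_signedSquareSeries_eq_zero one_ne_zero (unary h12),
    coeff_expand_signedSquareSeries_eq_zero two_ne_zero (unary h23),
    coeff_expand_signedSquareSeries_eq_zero three_ne_zero (unary h36),
    coeff_expand_signedSquareSeries_eq_zero _ (unary h60),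
    coeff_expand_signedSquareSeries_eq_zero _ (unary h120),
    coeff_expand_mul_expand_signedSquareSeries_eq_zero _ _ h12,
    coeff_expand_mul_expand_signedSquareSeries_eq_zero _ _ h13,
    coeff_expand_mul_expand_signedSquareSeries_eq_zero _ _ h23,
    coeff_expand_mul_expand_signedSquareSeries_eq_zero _ _ h26,
    coeff_expand_mul_expand_signedSquareSeries_eq_zero _ _ h36,
    coeff_expand_mul_expand_signedSquareSeries_eq_zero (i := 1) (j := 6) _ _
      (by simpa using hrep)] at h
  rw [schurSeries, coeff_mk] at h
  norm_num at h
  exact_mod_cast h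

end Representation

/-! ### Assembling moduli 8 and 3 -/

theorem theorem4p7 (p : ℕ) [Fact p.Prime] (hp : 5 ≤ p) (hleg : legendreSym p (-6) = -1)
    (i : ℕ) (hi₁ : 1 ≤ i) (hi₂ : i ≤ p - 1) (α n : ℕ) :
    schurOverpartitionCount 3
      (48 * p ^ (2 * α + 2) * n + 2 * (24 * i + 5 * p) * p ^ (2 * α + 1)) ≡ 0 [MOD 24] := by
  have hprime : p.Prime := Fact.out
  have hsq : p ^ 2 % 24 = 1 := by
    have h2 : ¬ 2 ∣ p := fun h ↦ by
      have := (Nat.prime_dvd_prime_iff_eq Nat.prime_two hprime).1 h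
      omega
    have h3 : ¬ 3 ∣ p := fun h ↦ by
      have := (Nat.prime_dvd_prime_iff_eq Nat.prime_three hprime).1 h
      omega
    have hr : p % 24 < 24 := Nat.mod_lt _ (by norm_num)
    have h2' : p % 24 % 2 ≠ 0 := by omega
    have h3' : p % 24 % 3 ≠ 0 := by omega
    rw [Nat.pow_mod]
    generalize p % 24 = r at *
    interval_cases r <;> simp_all
  obtain ⟨c, hc⟩ : ∃ c, p ^ (2 * α + 2) = 24 * c + 1 := by
    have h : p ^ (2 * α + 2) % 24 = 1 := by
      rw [show 2 * α + 2 = 2 * (α + 1) by ring, pow_mul, Nat.pow_mod, hsq, one_pow,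
        Nat.one_mod]
    exact ⟨p ^ (2 * α + 2) / 24, by omega⟩
  set N := 48 * p ^ (2 * α + 2) * n + 2 * (24 * i + 5 * p) * p ^ (2 * α + 1) with hN
  -- The term 10 p^(2α+2) equals 48 · 5c + 10.
  set m := p ^ (2 * α + 2) * n + i * p ^ (2 * α + 1) + 5 * c with hm
  have hN' : N = 48 * m + 10 := by
    rw [hN, hm]
    linear_combination 10 * hc
  -- This cofactor of p^(2α+1) in N is 48i mod p, with p ∤ 48 and 0 < i < p.
  have hv : ¬ p ∣ 2 * (24 * (p * n + i) + 5 * p) := by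
    rw [show 2 * (24 * (p * n + i) + 5 * p) = p * (48 * n + 10) + 48 * i by ring,
      Nat.dvd_add_right (dvd_mul_right _ _), hprime.dvd_mul, not_or]
    refine ⟨fun h ↦ ?_, Nat.not_dvd_of_pos_of_lt hi₁ (by omega)⟩
    rw [show 48 = 2 ^ 4 * 3 by norm_num, hprime.dvd_mul] at h
    rcases h with h | h
    · have := Nat.le_of_dvd two_pos (hprime.dvd_of_dvd_pow h)
      omega
    · have := Nat.le_of_dvd three_pos h
      omega
  have hNv : N = p ^ (2 * α + 1) * (2 * (24 * (p * n + i) + 5 * p)) := by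
    rw [hN]
    ring
  have h8 : 8 ∣ schurOverpartitionCount 3 N := by
    refine eight_dvd_schurOverpartitionCount (by omega) fun x y ↦ ?_
    rw [hNv]
    exact sq_add_six_mul_sq_ne hleg hv α x y
  have h3 : 3 ∣ schurOverpartitionCount 3 N := by
    rw [show N = 8 * (6 * m + 1) + 2 by omega]
    exact three_dvd_schurOverpartitionCount (by omega)
  rw [Nat.modEq_zero_iff_dvd]
  omega
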